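/- Let $(M,g)$ be an oriented smooth Riemannian manifold of dimension $n$ with Levi-Civita connection $\nabla$, and let $G\subset SO(n)$ be a closed subgroup with Lie algebra $\mathfrak g\subset\mathfrak{so}(n)$. Let $\mathfrak{so}(n)=\mathfrak g\oplus\mathfrak g^{\perp}$ be the orthogonal decomposition with respect to the $\mathrm{Ad}$-invariant inner product $-\mathrm{tr}(AB)$ (for $n\ge 3$ this is the orthogonal decomposition with respect to the Killing form). Suppose that $M$ carries a $G$-structure, that is, a smooth reduction $P$ of the bundle $SO(M)$ of oriented orthonormal frames to the structure group $G$. Let $\omega$ be the connection form of $\nabla$, and let $\nabla^G$ be the minimal $G$-connection, that is, the connection on $TM$ defined by the $\mathfrak g$-component $\omega_{\mathfrak g}$ of $\omega|_{P}$. Let $$\xi_XY=\nabla^G_XY-\nabla_XY$$ be the intrinsic torsion, and put $$\xi^{\rm alt}_XY=\tfrac12(\xi_XY-\xi_YX),\qquad \xi^{\rm sym}_XY=\tfrac12(\xi_XY+\xi_YX),\qquad \chi=\sum_i\xi_{e_i}e_i,$$ where $(e_i)$ is any local orthonormal frame. For a connection $D$ on $TM$ let $R^D(X,Y)=[D_X,D_Y]-D_{[X,Y]}$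 be its curvature and $\sum_{i,j}g(R^D(e_i,e_j)e_j,e_i)$ its scalar curvature; let $s$ and $s^G$ be the scalar curvatures of $\nabla$ and $\nabla^G$. For a $(1,2)$-tensor $A$ put $|A|^2=\sum_{i,j}|A_{e_i}e_j|^2$, and let $\mathrm{div}\,X=\mathrm{tr}(v\mapsto\nabla_vX)$. Then $\chi$ is a smooth vector field on $M$ and, at every point of $M$, $$2\,\mathrm{div}\,\chi=s^G-s+|\chi|^2+|\xi^{\rm alt}|^2-|\xi^{\rm sym}|^2 .$$ -/

import Mathlib

open Bundle
open scoped Manifold ContDiff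

noncomputable section

namespace GStr

/-! ### Riemannian geometry: Levi-Civita connection, divergence, curvature -/

section Riemannian

variable {E : Type*} [NormedAddCommGroup E] [NormedSpace ℝ E]
  {H : Type*} [TopologicalSpace H] {I : ModelWithCorners ℝ E H}
  {M : Type*} [TopologicalSpace M] [ChartedSpace H M]

instance [FiniteDimensional ℝ E] (x : M) : FiniteDimensional ℝ (TangentSpace I x) :=
  inferInstanceAs (FiniteDimensional ℝ E)

instance (x : M) : T2Space (TangentSpace I x) := inferInstanceAs (T2Space E)

variable (I M) in
/-- A (not necessarily continuous) vector field on `M`. -/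
abbrev VField := Π x : M, TangentSpace I x

variable [IsManifold I ∞ M]

variable (I M) in
/-- An affine connection `D` on `M`; `D Y x v` is `(D_v Y)(x)`. -/
abbrev AffineConnection := CovariantDerivative I E (TangentSpace I : M → Type _)

/-- A vector field with value `v` at `x` that is smooth near `x`. -/
abbrev extendVec {x : M} (v : TangentSpace I x) : VField I M := FiberBundle.extend E v

variable [RiemannianBundle (fun x : M ↦ TangentSpace I x)]

/-- The function `g(X, Y)` for two vector fields `X`, `Y`. -/
def dotf (X Y : VField I M) : M → ℝ := fun y ↦ inner ℝ (X y) (Y y)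

/-- The Koszul expression: the value of `g(∇_X Y, Z)` at `x` for the Levi-Civita connection. -/
def koszul (X Y Z : VField I M) (x : M) : ℝ :=
  (1 / 2) * (d% (dotf Y Z) x (X x) + d% (dotf X Z) x (Y x) - d% (dotf X Y) x (Z x)
    + inner ℝ (VectorField.mlieBracket I X Y x) (Z x)
    - inner ℝ (VectorField.mlieBracket I X Z x) (Y x)
    - inner ℝ (VectorField.mlieBracket I Y Z x) (X x))

variable [IsContMDiffRiemannianBundle I ∞ E (fun x : M ↦ TangentSpace I x)]

lemma mdiff_dotf {X Y : VField I M} {x : M} (hX : MDiffAt (T% X) x) (hY : MDiffAt (T% Y) x) :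
    MDiffAt (dotf X Y) x :=
  MDifferentiableAt.inner_bundle (IB := I) (F := E) (E := fun x : M ↦ TangentSpace I x)
    (b := fun y ↦ y) hX hY

variable [CompleteSpace E]

lemma koszul_add {X Y Y' Z : VField I M} {x : M} (hX : MDiffAt (T% X) x)
    (hY : MDiffAt (T% Y) x) (hY' : MDiffAt (T% Y') x) (hZ : MDiffAt (T% Z) x) :
    koszul X (Y + Y') Z x = koszul X Y Z x + koszul X Y' Z x := by
  have h1 : dotf (Y + Y') Z = dotf Y Z + dotf Y' Z := by
    ext y; simp [dotf, inner_add_left]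
  have h2 : dotf X (Y + Y') = dotf X Y + dotf X Y' := by
    ext y; simp [dotf, inner_add_right]
  simp only [koszul, h1, h2, mvfderiv_add (mdiff_dotf hY hZ) (mdiff_dotf hY' hZ),
    mvfderiv_add (mdiff_dotf hX hY) (mdiff_dotf hX hY'),
    VectorField.mlieBracket_add_left hY hY', VectorField.mlieBracket_add_right hY hY']
  simp [inner_add_left, inner_add_right]
  ring

lemma koszul_smul {f : M → ℝ} {X Y Z : VField I M} {x : M} (hf : MDiffAt f x)
    (hX : MDiffAt (T% X) x) (hY : MDiffAt (T% Y) x) (hZ : MDiffAt (T% Z) x) :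
    koszul X (f • Y) Z x = f x * koszul X Y Z x + d% f x (X x) * inner ℝ (Y x) (Z x) := by
  have h1 : dotf (f • Y) Z = f * dotf Y Z := by
    ext y; simp [dotf, inner_smul_left]
  have h2 : dotf X (f • Y) = f * dotf X Y := by
    ext y; simp [dotf, inner_smul_right]
  simp only [koszul, h1, h2, mvfderiv_mul hf (mdiff_dotf hY hZ),
    mvfderiv_mul hf (mdiff_dotf hX hY),
    VectorField.mlieBracket_smul_left hf hY, VectorField.mlieBracket_smul_right hf hY]
  simp [inner_add_left, inner_smul_left, inner_smul_right, dotf, real_inner_comm]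
  ring

lemma koszul_tensorial_left {Y Z : VField I M} {x : M}
    (hY : MDiffAt (T% Y) x) (hZ : MDiffAt (T% Z) x) :
    TensorialAt I E (fun X : VField I M ↦ koszul X Y Z x) x where
  smul {f X} hf hX := by
    have h1 : dotf (f • X) Z = f * dotf X Z := by
      ext y; simp [dotf, inner_smul_left]
    have h2 : dotf (f • X) Y = f * dotf X Y := by
      ext y; simp [dotf, inner_smul_left]
    simp only [koszul, h1, h2, mvfderiv_mul hf (mdiff_dotf hX hZ),
      mvfderiv_mul hf (mdiff_dotf hX hY), VectorField.mlieBracket_smul_left hf hX]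
    simp [inner_add_left, inner_smul_left, inner_smul_right, dotf, real_inner_comm]
    ring
  add {X X'} hX hX' := by
    have h1 : dotf (X + X') Z = dotf X Z + dotf X' Z := by
      ext y; simp [dotf, inner_add_left]
    have h2 : dotf (X + X') Y = dotf X Y + dotf X' Y := by
      ext y; simp [dotf, inner_add_left]
    simp only [koszul, h1, h2, mvfderiv_add (mdiff_dotf hX hZ) (mdiff_dotf hX' hZ),
      mvfderiv_add (mdiff_dotf hX hY) (mdiff_dotf hX' hY), VectorField.mlieBracket_add_left hX hX']
    simp [inner_add_left, inner_add_right]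
    ring

lemma koszul_tensorial_right {X Y : VField I M} {x : M}
    (hX : MDiffAt (T% X) x) (hY : MDiffAt (T% Y) x) :
    TensorialAt I E (fun Z : VField I M ↦ koszul X Y Z x) x where
  smul {f Z} hf hZ := by
    have h1 : dotf Y (f • Z) = f * dotf Y Z := by
      ext y; simp [dotf, inner_smul_right]
    have h2 : dotf X (f • Z) = f * dotf X Z := by
      ext y; simp [dotf, inner_smul_right]
    simp only [koszul, h1, h2, mvfderiv_mul hf (mdiff_dotf hX hZ),
      mvfderiv_mul hf (mdiff_dotf hY hZ), VectorField.mlieBracket_smul_right hf hZ]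
    simp [inner_add_left, inner_smul_left, inner_smul_right, dotf, real_inner_comm]
    ring
  add {Z Z'} hZ hZ' := by
    have h1 : dotf Y (Z + Z') = dotf Y Z + dotf Y Z' := by
      ext y; simp [dotf, inner_add_right]
    have h2 : dotf X (Z + Z') = dotf X Z + dotf X Z' := by
      ext y; simp [dotf, inner_add_right]
    simp only [koszul, h1, h2, mvfderiv_add (mdiff_dotf hY hZ) (mdiff_dotf hY hZ'),
      mvfderiv_add (mdiff_dotf hX hZ) (mdiff_dotf hX hZ'), VectorField.mlieBracket_add_right hZ hZ']
    simp [inner_add_left, inner_add_right]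
    ring

variable [FiniteDimensional ℝ E]

/-- An orthonormal basis of the tangent space at `x`. -/
abbrev onb (I : ModelWithCorners ℝ E H) {M : Type*} [TopologicalSpace M] [ChartedSpace H M]
    [RiemannianBundle (fun x : M ↦ TangentSpace I x)] (x : M) :=
  stdOrthonormalBasis ℝ (TangentSpace I x)

/-- The operation `(v, Y) ↦ ∇_v Y` of the Levi-Civita connection, given by the Koszul formula. -/
def leviCivitaFun (Y : VField I M) (x : M) : TangentSpace I x →L[ℝ] TangentSpace I x :=
  ∑ i, ∑ j, koszul (extendVec (onb I x i)) Y (extendVec (onb I x j)) x •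
    (innerSL ℝ (onb I x i)).smulRight (onb I x j)

lemma inner_leviCivitaFun {X Y Z : VField I M} {x : M} (hX : MDiffAt (T% X) x)
    (hY : MDiffAt (T% Y) x) (hZ : MDiffAt (T% Z) x) :
    inner ℝ (leviCivitaFun Y x (X x)) (Z x) = koszul X Y Z x := by
  have hb := TensorialAt.mkHom₂_apply (I := I) (F := E) (F' := E)
    (Φ := fun X Z : VField I M ↦ koszul X Y Z x) (x := x)
    (fun Z hZ ↦ koszul_tensorial_left hY hZ) (fun X hX ↦ koszul_tensorial_right hX hY) hX hZ
  rw [← hb, ← (onb I x).sum_repr' (X x), ← (onb I x).sum_repr' (Z x)]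
  simp [leviCivitaFun, TensorialAt.mkHom₂_apply_eq_extend, sum_inner, inner_sum,
    inner_smul_left, inner_smul_right, OrthonormalBasis.inner_eq_ite]

variable (I M) in
/-- The Levi-Civita connection of the Riemannian manifold `M`. -/
def leviCivita : AffineConnection I M where
  toFun := leviCivitaFun
  isCovariantDerivativeOnUniv :=
    { add := fun {Y Y' x} hY hY' _ ↦ by
        simp only [leviCivitaFun, ← Finset.sum_add_distrib, ← add_smul]
        refine Finset.sum_congr rfl fun i _ ↦ Finset.sum_congr rfl fun j _ ↦ ?_
        rw [koszul_add (FiberBundle.mdifferentiableAt_extend ..) hY hY' (FiberBundle.mdifferentiableAt_extend ..)]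
      leibniz := fun {Y f x} hY hf _ ↦ by
        ext v
        refine ext_inner_right ℝ fun z ↦ ?_
        have h1 := inner_leviCivitaFun (X := extendVec v) (Y := f • Y) (Z := extendVec z) (x := x)
          (FiberBundle.mdifferentiableAt_extend ..) (hf.smul_section hY) (FiberBundle.mdifferentiableAt_extend ..)
        have h2 := inner_leviCivitaFun (X := extendVec v) (Y := Y) (Z := extendVec z) (x := x)
          (FiberBundle.mdifferentiableAt_extend ..) hY (FiberBundle.mdifferentiableAt_extend ..)
        rw [koszul_smul hf (FiberBundle.mdifferentiableAt_extend ..) hY (FiberBundle.mdifferentiableAt_extend ..), ← h2] at h1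
        simpa [inner_add_left, inner_smul_left] using h1 }

/-- The Levi-Civita connection is metric. -/
lemma leviCivita_metric {X Y Z : VField I M} {x : M} (hX : MDiffAt (T% X) x)
    (hY : MDiffAt (T% Y) x) (hZ : MDiffAt (T% Z) x) :
    d% (dotf Y Z) x (X x) = inner ℝ (leviCivita I M Y x (X x)) (Z x) +
      inner ℝ (Y x) (leviCivita I M Z x (X x)) := by
  have h1 := inner_leviCivitaFun hX hY hZ
  have h2 := inner_leviCivitaFun hX hZ hY
  have h3 : dotf Z Y = dotf Y Z := by ext y; simp [dotf, real_inner_comm]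
  rw [real_inner_comm (leviCivita I M Z x (X x)) (Y x)]
  change _ = inner ℝ (leviCivitaFun Y x (X x)) (Z x) + inner ℝ (leviCivitaFun Z x (X x)) (Y x)
  rw [h1, h2, koszul, koszul, h3, VectorField.mlieBracket_swap_apply (V := Z)]
  simp [inner_neg_left]
  ring

/-- The Levi-Civita connection is torsion free. -/
lemma leviCivita_torsion {X Y : VField I M} {x : M} (hX : MDiffAt (T% X) x)
    (hY : MDiffAt (T% Y) x) :
    leviCivita I M Y x (X x) - leviCivita I M X x (Y x) = VectorField.mlieBracket I X Y x := by
  refine ext_inner_right ℝ fun z ↦ ?_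
  have hz : MDiffAt (T% (extendVec z)) x := FiberBundle.mdifferentiableAt_extend ..
  have h1 := inner_leviCivitaFun hX hY hz
  have h2 := inner_leviCivitaFun hY hX hz
  have h3 : dotf X Y = dotf Y X := by ext y; simp [dotf, real_inner_comm]
  simp only [FiberBundle.extend_apply_self] at h1 h2
  rw [inner_sub_left]
  change inner ℝ (leviCivitaFun Y x (X x)) z - inner ℝ (leviCivitaFun X x (Y x)) z = _
  rw [h1, h2, koszul, koszul, h3, VectorField.mlieBracket_swap_apply (V := Y) (W := X)]
  simp [inner_neg_left]
  ring

/-- The divergence `tr (v ↦ ∇_v X)` of a vector field. -/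
def divergence (X : VField I M) (x : M) : ℝ :=
  LinearMap.trace ℝ (TangentSpace I x) (leviCivita I M X x).toLinearMap

/-- The curvature `R(X, Y) Z = D_X D_Y Z - D_Y D_X Z - D_[X, Y] Z` of an affine connection `D`. -/
def curvature (D : AffineConnection I M) (X Y Z : VField I M) : VField I M := fun x ↦
  D (fun y ↦ D Z y (Y y)) x (X x) - D (fun y ↦ D Z y (X y)) x (Y x)
    - D Z x (VectorField.mlieBracket I X Y x)

/-- The scalar curvature `∑ i j, g(R(e i, e j) (e j), e i)` of an affine connection, where `e` is an
orthonormal basis. -/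
def scalarCurvature (D : AffineConnection I M) (x : M) : ℝ :=
  ∑ i, ∑ j, inner ℝ
    (curvature D (extendVec (onb I x i)) (extendVec (onb I x j)) (extendVec (onb I x j)) x)
    (onb I x i)

/-- The squared norm `∑ i j, ‖A (e i) (e j)‖²` of a `(1,2)`-tensor at `x`. -/
def tensorNormSq {x : M} (A : TangentSpace I x → TangentSpace I x → TangentSpace I x) : ℝ :=
  ∑ i, ∑ j, ‖A (onb I x i) (onb I x j)‖ ^ 2

end Riemannian

/-! ### `G`-structures, their minimal connection and intrinsic torsion -/

section GStructures

variable {n : ℕ}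

/-- The Lie algebra of a closed subgroup `G` of `SO(n)`: the tangent space of `G` at the identity,
i.e. the matrices that are velocities at `0` of curves in `G` through the identity. -/
def lieAlg (G : Subgroup (Matrix.specialOrthogonalGroup (Fin n) ℝ)) :
    Submodule ℝ (Matrix (Fin n) (Fin n) ℝ) where
  carrier := {A | ∃ γ : ℝ → Matrix.specialOrthogonalGroup (Fin n) ℝ, (∀ t, γ t ∈ G) ∧ γ 0 = 1 ∧
    ∀ i j, HasDerivAt (fun t ↦ (γ t).1 i j) (A i j) 0}
  zero_mem' := ⟨fun _ ↦ 1, fun _ ↦ G.one_mem, rfl, fun _ _ ↦ hasDerivAt_const _ _⟩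
  add_mem' := by
    rintro A B ⟨γ, hγ, hγ0, hA⟩ ⟨δ, hδ, hδ0, hB⟩
    refine ⟨fun t ↦ γ t * δ t, fun t ↦ G.mul_mem (hγ t) (hδ t), by simp [hγ0, hδ0], fun i j ↦ ?_⟩
    have h := HasDerivAt.fun_sum (u := Finset.univ)
      fun k (_ : k ∈ Finset.univ) ↦ (hA i k).mul (hB k j)
    simpa [hγ0, hδ0, Matrix.one_apply, Finset.sum_add_distrib, Matrix.mul_apply] using h
  smul_mem' := by
    rintro c A ⟨γ, hγ, hγ0, hA⟩
    refine ⟨fun t ↦ γ (c * t), fun t ↦ hγ _, by simp [hγ0], fun i j ↦ ?_⟩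
    have h1 : HasDerivAt (fun t : ℝ ↦ c * t) c 0 := by simpa using (hasDerivAt_id (0 : ℝ)).const_mul c
    have h2 : HasDerivAt (fun t ↦ (γ t).1 i j) (A i j) (c * 0) := by simpa using hA i j
    have h3 := h2.comp (0 : ℝ) h1
    rw [mul_comm] at h3
    exact h3

variable (n) in
/-- Matrices with the inner product `⟨A, B⟩ = tr(Aᵀ B)`; on `so(n)` this is `-tr(A B)`. -/
def matEuclid : Matrix (Fin n) (Fin n) ℝ ≃ₗ[ℝ] EuclideanSpace ℝ (Fin n × Fin n) where
  toFun A := WithLp.toLp 2 fun p ↦ A p.1 p.2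
  invFun v := Matrix.of fun i j ↦ v (i, j)
  map_add' _ _ := rfl
  map_smul' _ _ := rfl
  left_inv _ := rfl
  right_inv _ := rfl

/-- The orthogonal projection of matrices onto the Lie algebra of `G`. On `so(n)` it is the
projection `A ↦ A_𝔤` along the decomposition `so(n) = 𝔤 ⊕ 𝔤^⊥`. -/
def projLie (G : Subgroup (Matrix.specialOrthogonalGroup (Fin n) ℝ)) :
    Matrix (Fin n) (Fin n) ℝ →ₗ[ℝ] Matrix (Fin n) (Fin n) ℝ :=
  (matEuclid n).symm.toLinearMap ∘ₗ
    ((lieAlg G).map (matEuclid n).toLinearMap).starProjection.toLinearMap ∘ₗ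
    (matEuclid n).toLinearMap

variable {E : Type*} [NormedAddCommGroup E] [NormedSpace ℝ E]
  {H : Type*} [TopologicalSpace H] (I : ModelWithCorners ℝ E H)
  (M : Type*) [TopologicalSpace M] [ChartedSpace H M] [IsManifold I ∞ M]

variable (n) in
/-- An orientation of an `n`-manifold: orientations of the tangent spaces which, near each point,
are represented by a smooth local frame. -/
structure MOrientation where
  /-- The orientation of the tangent space at a point. -/
  at_ : ∀ x : M, Orientation ℝ (TangentSpace I x) (Fin n)
  locally_frame : ∀ x : M, ∃ (U : Set M) (s : Fin n → VField I M) (hs : IsLocalFrameOn I E ∞ s U),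
    IsOpen U ∧ x ∈ U ∧ ∀ y (hy : y ∈ U), (hs.toBasisAt hy).orientation = at_ y

variable {I M} [RiemannianBundle (fun x : M ↦ TangentSpace I x)] [FiniteDimensional ℝ E]

/-- `e` is an oriented orthonormal frame at `x`, i.e. an element of the fibre of `SO(M)`. -/
def IsOrientedFrame (o : MOrientation n I M) {x : M} (e : Fin n → TangentSpace I x) : Prop :=
  ∃ b : OrthonormalBasis (Fin n) ℝ (TangentSpace I x), ⇑b = e ∧ b.toBasis.orientation = o.at_ x

/-- The right action of matrices on frames: `(e · A)_j = ∑ i, A i j • e i`. -/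
def frameAct {x : M} (e : Fin n → TangentSpace I x) (A : Matrix (Fin n) (Fin n) ℝ) :
    Fin n → TangentSpace I x :=
  fun j ↦ ∑ i, A i j • e i

/-- A `G`-structure on an oriented Riemannian manifold: a reduction `P ⊆ SO(M)` of the bundle of
oriented orthonormal frames to `G ⊆ SO(n)`. The fibres of `P` are single `G`-orbits, and `P` has
smooth local sections. -/
structure GStructure (o : MOrientation n I M)
    (G : Subgroup (Matrix.specialOrthogonalGroup (Fin n) ℝ)) where
  /-- The fibre of `P` over a point. -/
  frames : ∀ x : M, Set (Fin n → TangentSpace I x)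
  isOriented : ∀ x, ∀ e ∈ frames x, IsOrientedFrame o e
  act_mem : ∀ x, ∀ e ∈ frames x, ∀ A ∈ G, frameAct e A.1 ∈ frames x
  transitive : ∀ x, ∀ e ∈ frames x, ∀ e' ∈ frames x, ∃ A ∈ G, e' = frameAct e A.1
  local_section : ∀ x, ∃ (U : Set M) (s : Fin n → VField I M), IsOpen U ∧ x ∈ U ∧
    (∀ i, CMDiff[U] ∞ (T% (s i))) ∧ ∀ y ∈ U, (fun i ↦ s i y) ∈ frames y

namespace GStructure

variable {o : MOrientation n I M} {G : Subgroup (Matrix.specialOrthogonalGroup (Fin n) ℝ)}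
  (P : GStructure o G)

/-- A (chosen) smooth local section of `P`, defined near the point `x`. -/
def sec (x : M) : Fin n → VField I M := (P.local_section x).choose_spec.choose

lemma sec_mem (x : M) : (fun i ↦ P.sec x i x) ∈ P.frames x :=
  (P.local_section x).choose_spec.choose_spec.2.2.2 x
    (P.local_section x).choose_spec.choose_spec.2.1

lemma sec_mdiff (x : M) (i : Fin n) : MDiffAt (T% (P.sec x i)) x := by
  obtain ⟨hU, hx, hs, -⟩ := (P.local_section x).choose_spec.choose_spec
  exact ((hs i).contMDiffAt (hU.mem_nhds hx)).mdifferentiableAt (by simp)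

variable [CompleteSpace E] [IsContMDiffRiemannianBundle I ∞ E (fun x : M ↦ TangentSpace I x)]

/-- The pull-back of the Levi-Civita connection form by a local orthonormal frame `s`:
`ω(v)_{ij} = g(s_i, ∇_v s_j)`. -/
def connectionForm (s : Fin n → VField I M) (x : M) :
    TangentSpace I x →ₗ[ℝ] Matrix (Fin n) (Fin n) ℝ where
  toFun v := Matrix.of fun i j ↦ inner ℝ (s i x) (leviCivita I M (s j) x v)
  map_add' v w := by ext i j; simp [inner_add_right]
  map_smul' c v := by ext i j; simp [inner_smul_right]

/-- The connection `∇^G` given by the `𝔤`-component `ω_𝔤` of the Levi-Civita connection form: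
if `Y = ∑ i, Y_i s_i` in a local section `s` of `P`, then
`∇^G_v Y = ∑ i, (d Y_i (v) + ∑ j, (ω_𝔤(v))_{ij} Y_j) s_i`. This does not depend on the section. -/
def minimalConnection : AffineConnection I M where
  toFun Y x := ∑ i, (d% (dotf (P.sec x i) Y) x +
    ∑ j, dotf (P.sec x j) Y x • LinearMap.toContinuousLinearMap
      (Matrix.entryLinearMap ℝ ℝ i j ∘ₗ projLie G ∘ₗ connectionForm (P.sec x) x)).smulRight
    (P.sec x i x)
  isCovariantDerivativeOnUniv :=
    { add := fun {Y Y' x} hY hY' _ ↦ by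
        have h (i : Fin n) : dotf (P.sec x i) (Y + Y') =
            dotf (P.sec x i) Y + dotf (P.sec x i) Y' := by
          ext y; simp [dotf, inner_add_right]
        ext v
        simp only [h, mvfderiv_add (mdiff_dotf (P.sec_mdiff x _) hY)
          (mdiff_dotf (P.sec_mdiff x _) hY')]
        simp only [add_smul, Pi.add_apply, Finset.sum_add_distrib, _root_.sum_apply,
          ContinuousLinearMap.smulRight_apply, _root_.add_apply]
        abel
      leibniz := fun {Y f x} hY hf _ ↦ by
        have h (i : Fin n) : dotf (P.sec x i) (f • Y) = f * dotf (P.sec x i) Y := by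
          ext y; simp [dotf, inner_smul_right]
        obtain ⟨b, hb, -⟩ := P.isOriented x _ (P.sec_mem x)
        have hY0 : Y x = ∑ i, dotf (P.sec x i) Y x • P.sec x i x := by
          rw [← b.sum_repr' (Y x), hb]
          simp only [dotf]
        ext v
        simp only [h, mvfderiv_mul hf (mdiff_dotf (P.sec_mdiff x _) hY)]
        simp only [_root_.sum_apply, ContinuousLinearMap.smulRight_apply,
          _root_.add_apply, _root_.smul_apply, smul_eq_mul, Pi.mul_apply,
          mul_assoc, ← Finset.mul_sum]
        conv_rhs => rw [hY0]
        rw [Finset.smul_sum, Finset.smul_sum, ← Finset.sum_add_distrib]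
        refine Finset.sum_congr rfl fun i _ ↦ ?_
        rw [smul_smul, smul_smul, ← add_smul]
        ring_nf }

/-- The intrinsic torsion `ξ_v w = ∇^G_v w - ∇_v w`. -/
def torsion (x : M) (v w : TangentSpace I x) : TangentSpace I x :=
  CovariantDerivative.difference P.minimalConnection (leviCivita I M) x w v

/-- The skew-symmetric component `ξ^alt` of the intrinsic torsion. -/
def torsionAlt (x : M) (v w : TangentSpace I x) : TangentSpace I x :=
  (1 / 2 : ℝ) • (P.torsion x v w - P.torsion x w v)

/-- The symmetric component `ξ^sym` of the intrinsic torsion. -/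
def torsionSym (x : M) (v w : TangentSpace I x) : TangentSpace I x :=
  (1 / 2 : ℝ) • (P.torsion x v w + P.torsion x w v)

/-- The characteristic vector field `χ = ∑ i, ξ_{e i} (e i)`. -/
def charField : VField I M := fun x ↦ ∑ i, P.torsion x (onb I x i) (onb I x i)

end GStructure

end GStructures

end GStr

end

noncomputable section

namespace GStr

open scoped Matrix Topology

/-! ### The Lie algebra of a subgroup of `SO(n)` and its orthogonal projection -/

section LieAlgebra

variable {n : ℕ} {G : Subgroup (Matrix.specialOrthogonalGroup (Fin n) ℝ)}

/-! Write `∇^G = ∇ + ξ`. As `∇` is torsion free, `R^G(X,Y)Z - R(X,Y)Z = (∇_X ξ)_Y Z - (∇_Y ξ)_X Z +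
ξ_X ξ_Y Z - ξ_Y ξ_X Z` (`curvature_sub`). Put `X = e_i`, `Y = Z = e_j`, pair with `e_i` and sum.
Every `ξ_X` is skew, hence so is every `(∇_V ξ)_X` (`covDerivHom_skew`), and `∇` commutes with
contraction (`leviCivita_contr`); therefore each of the two derivative terms contributes `div χ`.
The quadratic terms contribute `-|χ|²` and `∑ g(ξ_{e_i} e_j, ξ_{e_j} e_i) = |ξ^sym|² - |ξ^alt|²`.
This is `two_mul_divergence_contr`, which holds for any differentiable skew field of bilinear maps,
given a smooth local orthonormal frame.

It remains to see that `ξ` is such a field. Skewness is pointwise, since `𝔤 ⊆ so(n)`. Regularity is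
not evident, because `minimalConnection` uses a separately chosen section of `P` at every point. Two
sections differ by a `G`-valued function `A`, and the connection form becomes `A⁻¹ ω A + A⁻¹ dA`.
The last term lies in `𝔤`, and the projection to `𝔤` commutes with `Ad(G)`; so the `𝔤^⊥`-part only
gets conjugated (`torsionForm_change`). Hence `ξ` can be computed near a point in one smooth section
(`torsion_eq_frameTorsion`), where smoothness is visible. -/

lemma transpose_mul_self_of_mem_SO (A : Matrix.specialOrthogonalGroup (Fin n) ℝ) :
    A.1ᵀ * A.1 = 1 := by
  have h := (Matrix.mem_specialOrthogonalGroup_iff.1 A.2).1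
  exact (Matrix.mem_orthogonalGroup_iff' (Fin n) ℝ).1 h

lemma mul_transpose_self_of_mem_SO (A : Matrix.specialOrthogonalGroup (Fin n) ℝ) :
    A.1 * A.1ᵀ = 1 :=
  mul_eq_one_comm.1 (transpose_mul_self_of_mem_SO A)

lemma coe_inv_SO (A : Matrix.specialOrthogonalGroup (Fin n) ℝ) : (A⁻¹).1 = A.1ᵀ := by
  have h : (A⁻¹).1 * A.1 = 1 := congrArg Subtype.val (inv_mul_cancel A)
  calc (A⁻¹).1 = (A⁻¹).1 * (A.1 * A.1ᵀ) := by rw [mul_transpose_self_of_mem_SO, mul_one]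
    _ = A.1ᵀ := by rw [← mul_assoc, h, one_mul]

/-- Differentiate `γᵀ γ = 1` at `0`. -/
lemma transpose_eq_neg_of_mem_lieAlg {A : Matrix (Fin n) (Fin n) ℝ} (hA : A ∈ lieAlg G) :
    Aᵀ = -A := by
  obtain ⟨γ, -, h0, hd⟩ := hA
  ext i j
  have h1 := HasDerivAt.fun_sum (u := Finset.univ)
    fun k (_ : k ∈ Finset.univ) ↦ (hd k i).mul (hd k j)
  have h2 : (fun t ↦ ∑ k, (γ t).1 k i * (γ t).1 k j) = fun _ ↦ (1 : Matrix (Fin n) (Fin n) ℝ) i j := by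
    ext t
    rw [← transpose_mul_self_of_mem_SO (γ t)]
    simp [Matrix.mul_apply]
  have h3 : HasDerivAt (fun t ↦ ∑ k, (γ t).1 k i * (γ t).1 k j) 0 0 := h2 ▸ hasDerivAt_const _ _
  have h4 := h1.unique h3
  simp [h0, Matrix.one_apply, Finset.sum_add_distrib] at h4
  simp only [Matrix.transpose_apply, Matrix.neg_apply]
  linarith

/-- Conjugating a curve in `G` by an element of `G` gives a curve in `G` with conjugated velocity.
-/
lemma conj_mem_lieAlg {A : Matrix (Fin n) (Fin n) ℝ} (hA : A ∈ lieAlg G)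
    {B : Matrix.specialOrthogonalGroup (Fin n) ℝ} (hB : B ∈ G) : B.1 * A * B.1ᵀ ∈ lieAlg G := by
  obtain ⟨γ, hγ, h0, hd⟩ := hA
  refine ⟨fun t ↦ B * γ t * B⁻¹, fun t ↦ G.mul_mem (G.mul_mem hB (hγ t)) (G.inv_mem hB),
    by simp [h0], fun i j ↦ ?_⟩
  have h := HasDerivAt.fun_sum (u := Finset.univ) fun k (_ : k ∈ Finset.univ) ↦
    (HasDerivAt.fun_sum (u := Finset.univ) fun l (_ : l ∈ Finset.univ) ↦
      (hd l k).const_mul (B.1 i l)).mul_const (B.1 j k)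
  simpa [Matrix.mul_apply, coe_inv_SO] using h

lemma inner_matEuclid (A B : Matrix (Fin n) (Fin n) ℝ) :
    inner ℝ (matEuclid n A) (matEuclid n B) = (Aᵀ * B).trace := by
  have h (C : Matrix (Fin n) (Fin n) ℝ) (i j : Fin n) : matEuclid n C (i, j) = C i j := rfl
  simp only [PiLp.inner_apply, Matrix.trace, Matrix.mul_apply, Fintype.sum_prod_type, h,
    Matrix.diag_apply, Matrix.transpose_apply]
  rw [Finset.sum_comm]
  simp [mul_comm]

lemma projLie_mem (A : Matrix (Fin n) (Fin n) ℝ) : projLie G A ∈ lieAlg G := by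
  obtain ⟨B, hB, h⟩ := ((lieAlg G).map (matEuclid n).toLinearMap).starProjection_apply_mem
    (matEuclid n A)
  have : projLie G A = B := by
    simp only [projLie, LinearMap.comp_apply]
    exact (matEuclid n).symm_apply_eq.2 h.symm
  rwa [this]

lemma trace_projLie (A : Matrix (Fin n) (Fin n) ℝ) {B : Matrix (Fin n) (Fin n) ℝ}
    (hB : B ∈ lieAlg G) : ((A - projLie G A)ᵀ * B).trace = 0 := by
  rw [← inner_matEuclid, map_sub]
  have h := Submodule.starProjection_inner_eq_zero
    (K := (lieAlg G).map (matEuclid n).toLinearMap) (matEuclid n A) (matEuclid n B) ⟨B, hB, rfl⟩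
  simpa [projLie] using h

lemma eq_projLie {A B : Matrix (Fin n) (Fin n) ℝ} (hB : B ∈ lieAlg G)
    (h : ∀ C ∈ lieAlg G, ((A - B)ᵀ * C).trace = 0) : projLie G A = B := by
  have := Submodule.eq_starProjection_of_mem_of_inner_eq_zero
    (K := (lieAlg G).map (matEuclid n).toLinearMap) (u := matEuclid n A) (v := matEuclid n B)
    ⟨B, hB, rfl⟩ (by
      rintro _ ⟨C, hC, rfl⟩
      rw [← map_sub]
      exact (inner_matEuclid _ _).trans (h C hC))
  simp only [projLie, LinearMap.comp_apply]
  exact (matEuclid n).symm_apply_eq.2 this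

lemma projLie_of_mem {A : Matrix (Fin n) (Fin n) ℝ} (hA : A ∈ lieAlg G) : projLie G A = A :=
  eq_projLie hA (by simp)

/-- Conjugation by an element of `G` preserves both `𝔤` and the trace form, so it commutes with the
orthogonal projection. -/
lemma projLie_conj (A : Matrix (Fin n) (Fin n) ℝ)
    {B : Matrix.specialOrthogonalGroup (Fin n) ℝ} (hB : B ∈ G) :
    projLie G (B.1ᵀ * A * B.1) = B.1ᵀ * projLie G A * B.1 := by
  refine eq_projLie ?_ fun C hC ↦ ?_
  · simpa [coe_inv_SO] using conj_mem_lieAlg (projLie_mem A) (G.inv_mem hB)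
  · have h := trace_projLie A (conj_mem_lieAlg hC hB)
    rw [← sub_mul, ← mul_sub, Matrix.transpose_mul, Matrix.transpose_mul, Matrix.transpose_transpose,
      Matrix.mul_assoc, Matrix.trace_mul_comm, ← h]
    simp only [Matrix.mul_assoc]

end LieAlgebra

/-! ### Orthonormal frames -/

section Frames

variable {E : Type*} [NormedAddCommGroup E] [NormedSpace ℝ E]
  {H : Type*} [TopologicalSpace H] {I : ModelWithCorners ℝ E H}
  {M : Type*} [TopologicalSpace M] [ChartedSpace H M]
  [RiemannianBundle (fun x : M ↦ TangentSpace I x)] {ι κ : Type*} [Fintype ι] [Fintype κ]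

variable (I) in
/-- The family `s` consists of orthonormal bases of the tangent spaces at the points of `U`. -/
def IsOrthonormalOn (s : ι → VField I M) (U : Set M) : Prop :=
  ∀ y ∈ U, ∃ b : OrthonormalBasis ι ℝ (TangentSpace I y), ∀ i, b i = s i y

lemma IsOrthonormalOn.sum_dotf {s : ι → VField I M} {U : Set M} (hs : IsOrthonormalOn I s U)
    {y : M} (hy : y ∈ U) (v : TangentSpace I y) : ∑ i, (inner ℝ (s i y) v) • s i y = v := by
  obtain ⟨b, hb⟩ := hs y hy
  simpa [hb] using b.sum_repr' v

/-- Allows the pointwise chosen `onb`, which need not vary continuously, to be replaced by a smooth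
frame in contractions. -/
lemma sum_apply_orthonormalBasis {V W : Type*} [NormedAddCommGroup V] [InnerProductSpace ℝ V]
    [AddCommGroup W] [Module ℝ W] (b : OrthonormalBasis ι ℝ V) (c : OrthonormalBasis κ ℝ V)
    (B : V →ₗ[ℝ] V →ₗ[ℝ] W) : ∑ i, B (b i) (b i) = ∑ j, B (c j) (c j) := by
  classical
  have h (i : ι) : B (b i) (b i) = ∑ j, ∑ k, (inner ℝ (c j) (b i) * inner ℝ (b i) (c k)) •
      B (c j) (c k) := by
    conv_lhs => rw [← c.sum_repr' (b i)]
    simp only [map_sum, map_smul, LinearMap.sum_apply, LinearMap.smul_apply, Finset.smul_sum,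
      smul_smul]
    rw [Finset.sum_comm]
    simp only [real_inner_comm, mul_comm]
  simp only [h]
  rw [Finset.sum_comm]
  refine Finset.sum_congr rfl fun j _ ↦ ?_
  rw [Finset.sum_comm]
  simp only [← Finset.sum_smul, b.sum_inner_mul_inner, c.inner_eq_ite, ite_smul, one_smul, zero_smul,
    Finset.sum_ite_eq, Finset.mem_univ, if_true]

end Frames

/-! ### Smoothness of derivatives and of the Levi-Civita connection -/

section Smoothness

variable {E : Type*} [NormedAddCommGroup E] [NormedSpace ℝ E]
  {H : Type*} [TopologicalSpace H] {I : ModelWithCorners ℝ E H}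
  {M : Type*} [TopologicalSpace M] [ChartedSpace H M] [IsManifold I ∞ M]

lemma contMDiffAt_mlieBracket [CompleteSpace E] {X Y : VField I M} {x : M} (hX : CMDiffAt ∞ (T% X) x)
    (hY : CMDiffAt ∞ (T% Y) x) : CMDiffAt ∞ (T% (VectorField.mlieBracket I X Y)) x :=
  have : IsManifold I (minSmoothness ℝ 2) M := by
    rw [minSmoothness_of_isRCLikeNormedField]; infer_instance
  have : IsManifold I (((⊤ : ℕ∞) : ℕ∞ω) + 1) M := inferInstanceAs (IsManifold I ∞ M)
  ContMDiffAt.mlieBracket_vectorField (m := ⊤) (n := ⊤) hX hY (by simp)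

lemma contMDiffAt_mvfderiv_apply {f : M → ℝ} {X : VField I M} {x : M}
    (hf : CMDiffAt ∞ f x) (hX : CMDiffAt ∞ (T% X) x) :
    CMDiffAt ∞ (fun y ↦ d% f y (X y)) x := by
  have h1 := hf.mfderiv_const (m := ∞) (by simp)
  have h2 := h1.clm_apply_of_inCoordinates (v := X) hX hf
  exact (contMDiff_snd_tangentBundle_modelSpace ℝ 𝓘(ℝ, ℝ)).contMDiffAt.comp x h2

variable [RiemannianBundle (fun x : M ↦ TangentSpace I x)]
  [IsContMDiffRiemannianBundle I ∞ E (fun x : M ↦ TangentSpace I x)]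

lemma contMDiffAt_dotf {X Y : VField I M} {x : M} (hX : CMDiffAt ∞ (T% X) x)
    (hY : CMDiffAt ∞ (T% Y) x) : CMDiffAt ∞ (dotf X Y) x :=
  ContMDiffAt.inner_bundle (IB := I) (F := E) (E := fun x : M ↦ TangentSpace I x)
    (b := fun y ↦ y) hX hY

variable [CompleteSpace E]

lemma contMDiffAt_koszul {X Y Z : VField I M} {x : M} (hX : CMDiffAt ∞ (T% X) x)
    (hY : CMDiffAt ∞ (T% Y) x) (hZ : CMDiffAt ∞ (T% Z) x) :
    CMDiffAt ∞ (koszul X Y Z) x := by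
  have h1 := contMDiffAt_mvfderiv_apply (contMDiffAt_dotf hY hZ) hX
  have h2 := contMDiffAt_mvfderiv_apply (contMDiffAt_dotf hX hZ) hY
  have h3 := contMDiffAt_mvfderiv_apply (contMDiffAt_dotf hX hY) hZ
  have h4 := contMDiffAt_dotf (contMDiffAt_mlieBracket hX hY) hZ
  have h5 := contMDiffAt_dotf (contMDiffAt_mlieBracket hX hZ) hY
  have h6 := contMDiffAt_dotf (contMDiffAt_mlieBracket hY hZ) hX
  exact contMDiffAt_const.mul (((((h1.add h2).sub h3).add h4).sub h5).sub h6)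

variable [FiniteDimensional ℝ E] {ι : Type*} [Fintype ι]

/-- `leviCivitaFun` is built from extensions that change with the point. In a fixed orthonormal
frame the coefficients are Koszul expressions of smooth fields, hence smooth. -/
lemma contMDiffAt_leviCivita {s : ι → VField I M} {U : Set M} {x : M} (hU : U ∈ 𝓝 x)
    (hs : ∀ y ∈ U, ∀ i, CMDiffAt ∞ (T% (s i)) y) (ho : IsOrthonormalOn I s U)
    {Y Z : VField I M} (hY : CMDiffAt ∞ (T% Y) x) (hZ : CMDiffAt ∞ (T% Z) x) :
    CMDiffAt ∞ (T% (fun y ↦ leviCivita I M Z y (Y y))) x := by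
  have hx := mem_of_mem_nhds hU
  have h : CMDiffAt ∞ (T% (fun y ↦ ∑ i, koszul Y Z (s i) y • s i y)) x :=
    ContMDiffAt.sum_section fun i _ ↦
      (contMDiffAt_koszul hY hZ (hs x hx i)).smul_section (hs x hx i)
  refine h.congr_of_eventuallyEq ?_
  -- `C^∞` at a point yields a neighbourhood of regularity only for each finite order; order `1` is
  -- enough for the Koszul formula.
  filter_upwards [hU, contMDiffAt_iff_contMDiffAt_nhds (by simp) |>.1 (hY.of_le (m := 1) (by simp)),
    contMDiffAt_iff_contMDiffAt_nhds (by simp) |>.1 (hZ.of_le (m := 1) (by simp))] with y hy hYy hZy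
  congr 1
  rw [← ho.sum_dotf hy (leviCivita I M Z y (Y y))]
  refine Finset.sum_congr rfl fun i _ ↦ ?_
  rw [← inner_leviCivitaFun (hYy.mdifferentiableAt (by simp)) (hZy.mdifferentiableAt (by simp))
    ((hs y hy i).mdifferentiableAt (by simp)), real_inner_comm]
  rfl

end Smoothness

/-! ### Change of the metric connection by a skew-symmetric tensor -/

section Curvature

variable {E : Type*} [NormedAddCommGroup E] [NormedSpace ℝ E]
  {H : Type*} [TopologicalSpace H] {I : ModelWithCorners ℝ E H}
  {M : Type*} [TopologicalSpace M] [ChartedSpace H M]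

lemma mvfderiv_congr {f g : M → ℝ} {x : M} (h : f =ᶠ[𝓝 x] g) : d% f x = d% g x := by
  ext v
  exact DFunLike.congr_fun h.mfderiv_eq v

variable [IsManifold I ∞ M]

lemma connection_congr (D : AffineConnection I M) {Y Z : VField I M} {x : M}
    (hZ : MDiffAt (T% Z) x) (h : ∀ᶠ y in 𝓝 x, Y y = Z y) : D Y x = D Z x := by
  have hY : MDiffAt (T% Y) x := hZ.congr_of_eventuallyEq (h.mono fun y hy ↦ by simp [hy])
  exact D.isCovariantDerivativeOnUniv.congr_of_eventuallyEq hY hZ Filter.univ_mem h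

lemma connection_sum (D : AffineConnection I M) {ι : Type*} (s : Finset ι) {Y : ι → VField I M}
    {x : M} (hY : ∀ i, MDiffAt (T% (Y i)) x) :
    D (fun y ↦ ∑ i ∈ s, Y i y) x = ∑ i ∈ s, D (Y i) x := by
  classical
  induction s using Finset.induction_on with
  | empty => simpa only [Finset.sum_empty] using! congrFun D.zero x
  | insert i s hi ih =>
    simp only [Finset.sum_insert hi, ← ih]
    exact D.isCovariantDerivativeOnUniv.add (hY i) (MDifferentiableAt.sum_section fun j _ ↦ hY j)

variable [FiniteDimensional ℝ E] [CompleteSpace E]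
  [RiemannianBundle (fun x : M ↦ TangentSpace I x)]
  [IsContMDiffRiemannianBundle I ∞ E (fun x : M ↦ TangentSpace I x)]

lemma leviCivita_metric_apply {Y Z : VField I M} {x : M} (hY : MDiffAt (T% Y) x)
    (hZ : MDiffAt (T% Z) x) (v : TangentSpace I x) :
    d% (dotf Y Z) x v = inner ℝ (leviCivita I M Y x v) (Z x) +
      inner ℝ (Y x) (leviCivita I M Z x v) := by
  simpa using leviCivita_metric (X := extendVec v) (FiberBundle.mdifferentiableAt_extend ..) hY hZ

/-- A field of bilinear maps `(w, v) ↦ A_v w` on the tangent spaces. -/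
abbrev BilinField (I : ModelWithCorners ℝ E H) (M : Type*) [TopologicalSpace M]
    [ChartedSpace H M] :=
  Π x : M, TangentSpace I x →L[ℝ] TangentSpace I x →L[ℝ] TangentSpace I x

/-- The tensor field `A` is differentiable. -/
def BilinField.IsDiff (A : BilinField I M) : Prop :=
  ∀ ⦃Y Z : VField I M⦄ ⦃x : M⦄, MDiffAt (T% Y) x → MDiffAt (T% Z) x →
    MDiffAt (T% (fun y ↦ A y (Z y) (Y y))) x

/-- The endomorphisms `A_v` are skew-symmetric. -/
def BilinField.IsSkew (A : BilinField I M) : Prop :=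
  ∀ (x : M) (u v w : TangentSpace I x), inner ℝ (A x w v) u = - inner ℝ w (A x u v)

/-- The covariant derivative `(∇_v A)_Y Z`. -/
def covDeriv (A : BilinField I M) (x : M) (v : TangentSpace I x) (Y Z : VField I M) :
    TangentSpace I x :=
  leviCivita I M (fun y ↦ A y (Z y) (Y y)) x v - A x (Z x) (leviCivita I M Y x v) -
    A x (leviCivita I M Z x v) (Y x)

variable {A : BilinField I M}

/-- The derivative of `f` produced by differentiating `A_{fY} Z` cancels the one from `A_{∇(fY)} Z`.
-/
lemma covDeriv_tensorial_left (hA : A.IsDiff) {x : M} (v : TangentSpace I x) {Z : VField I M}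
    (hZ : MDiffAt (T% Z) x) : TensorialAt I E (fun Y : VField I M ↦ covDeriv A x v Y Z) x where
  smul {f Y} hf hY := by
    have h : (fun y ↦ A y (Z y) ((f • Y) y)) = f • fun y ↦ A y (Z y) (Y y) := by ext y; simp
    simp only [covDeriv, h, (leviCivita I M).isCovariantDerivativeOnUniv.leibniz (hA hY hZ) hf,
      (leviCivita I M).isCovariantDerivativeOnUniv.leibniz hY hf]
    simp [smul_sub]
  add {Y Y'} hY hY' := by
    have h : (fun y ↦ A y (Z y) ((Y + Y') y)) =
      (fun y ↦ A y (Z y) (Y y)) + fun y ↦ A y (Z y) (Y' y) := by ext y; simp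
    simp only [covDeriv, h, (leviCivita I M).isCovariantDerivativeOnUniv.add (hA hY hZ) (hA hY' hZ),
      (leviCivita I M).isCovariantDerivativeOnUniv.add hY hY']
    simp
    abel

lemma covDeriv_tensorial_right (hA : A.IsDiff) {x : M} (v : TangentSpace I x) {Y : VField I M}
    (hY : MDiffAt (T% Y) x) : TensorialAt I E (fun Z : VField I M ↦ covDeriv A x v Y Z) x where
  smul {f Z} hf hZ := by
    have h : (fun y ↦ A y ((f • Z) y) (Y y)) = f • fun y ↦ A y (Z y) (Y y) := by ext y; simp
    simp only [covDeriv, h, (leviCivita I M).isCovariantDerivativeOnUniv.leibniz (hA hY hZ) hf,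
      (leviCivita I M).isCovariantDerivativeOnUniv.leibniz hZ hf]
    simp [smul_sub]
    abel
  add {Z Z'} hZ hZ' := by
    have h : (fun y ↦ A y ((Z + Z') y) (Y y)) =
      (fun y ↦ A y (Z y) (Y y)) + fun y ↦ A y (Z' y) (Y y) := by ext y; simp
    simp only [covDeriv, h, (leviCivita I M).isCovariantDerivativeOnUniv.add (hA hY hZ) (hA hY hZ'),
      (leviCivita I M).isCovariantDerivativeOnUniv.add hZ hZ']
    simp
    abel

/-- The covariant derivative `∇_v A` as a bilinear map. -/
def covDerivHom (hA : A.IsDiff) (x : M) (v : TangentSpace I x) :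
    TangentSpace I x →L[ℝ] TangentSpace I x →L[ℝ] TangentSpace I x :=
  TensorialAt.mkHom₂ (I := I) (F := E) (F' := E) (fun Y Z ↦ covDeriv A x v Y Z) x
    (fun _ hZ ↦ covDeriv_tensorial_left hA v hZ) (fun _ hY ↦ covDeriv_tensorial_right hA v hY)

lemma covDerivHom_apply (hA : A.IsDiff) {x : M} (v : TangentSpace I x) {Y Z : VField I M}
    (hY : MDiffAt (T% Y) x) (hZ : MDiffAt (T% Z) x) :
    covDerivHom hA x v (Y x) (Z x) = covDeriv A x v Y Z :=
  TensorialAt.mkHom₂_apply (I := I) (F := E) (F' := E) (Φ := fun Y Z ↦ covDeriv A x v Y Z)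
    (fun _ hZ ↦ covDeriv_tensorial_left hA v hZ) (fun _ hY ↦ covDeriv_tensorial_right hA v hY) hY hZ

/-- Differentiate `g(A_u w, z) = -g(w, A_u z)` with the metric connection; the terms containing
derivatives of `u`, `w`, `z` cancel by skewness of `A` itself. -/
lemma covDerivHom_skew (hA : A.IsDiff) (hs : A.IsSkew) {x : M} (v u w z : TangentSpace I x) :
    inner ℝ (covDerivHom hA x v u w) z = - inner ℝ w (covDerivHom hA x v u z) := by
  have hu : MDiffAt (T% (extendVec u)) x := FiberBundle.mdifferentiableAt_extend ..
  have hw : MDiffAt (T% (extendVec w)) x := FiberBundle.mdifferentiableAt_extend ..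
  have hz : MDiffAt (T% (extendVec z)) x := FiberBundle.mdifferentiableAt_extend ..
  have h1 := covDerivHom_apply hA v hu hw
  have h2 := covDerivHom_apply hA v hu hz
  have h3 := leviCivita_metric_apply (hA hu hw) hz v
  have h4 := leviCivita_metric_apply hw (hA hu hz) v
  have h5 : dotf (fun y ↦ A y (extendVec w y) (extendVec u y)) (extendVec z) =
      - dotf (extendVec w) (fun y ↦ A y (extendVec z y) (extendVec u y)) := by
    ext y
    exact hs _ _ _ _
  rw [h5, mvfderiv_neg, _root_.neg_apply, h4] at h3
  simp only [FiberBundle.extend_apply_self] at h1 h2 h3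
  rw [h1, h2, covDeriv, covDeriv]
  simp only [FiberBundle.extend_apply_self, inner_sub_left, inner_sub_right]
  rw [hs x z u (leviCivita I M (extendVec w) x v), hs x z (leviCivita I M (extendVec u) x v) w]
  have h6 := hs x (leviCivita I M (extendVec z) x v) u w
  linarith

/-- The curvature of `D = ∇ + A`. -/
lemma curvature_sub (hA : A.IsDiff) {D : AffineConnection I M}
    (hD : ∀ (Z : VField I M) (y : M), MDiffAt (T% Z) y →
      ∀ v, D Z y v = leviCivita I M Z y v + A y (Z y) v)
    {X Y Z : VField I M} {x : M} (hX : MDiffAt (T% X) x) (hY : MDiffAt (T% Y) x)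
    (hZ : ∀ᶠ y in 𝓝 x, MDiffAt (T% Z) y)
    (hXZ : MDiffAt (T% (fun y ↦ leviCivita I M Z y (X y))) x)
    (hYZ : MDiffAt (T% (fun y ↦ leviCivita I M Z y (Y y))) x) :
    curvature D X Y Z x - curvature (leviCivita I M) X Y Z x =
      covDerivHom hA x (X x) (Y x) (Z x) - covDerivHom hA x (Y x) (X x) (Z x) +
      A x (A x (Z x) (Y x)) (X x) - A x (A x (Z x) (X x)) (Y x) := by
  have hZx := hZ.self_of_nhds
  -- Expansion of `(∇ + A)_v (∇_W Z + A_W Z)`. The inner formula is needed on a neighbourhood, since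
  -- it gets differentiated.
  have key (W : VField I M) (hW : MDiffAt (T% W) x)
      (hWZ : MDiffAt (T% (fun y ↦ leviCivita I M Z y (W y))) x) (v : TangentSpace I x) :
      D (fun y ↦ D Z y (W y)) x v = leviCivita I M (fun y ↦ leviCivita I M Z y (W y)) x v +
        leviCivita I M (fun y ↦ A y (Z y) (W y)) x v + A x (leviCivita I M Z x (W x)) v +
        A x (A x (Z x) (W x)) v := by
    have h1 : MDiffAt (T% ((fun y ↦ leviCivita I M Z y (W y)) + fun y ↦ A y (Z y) (W y))) x :=
      mdifferentiableAt_add_section hWZ (hA hW hZx)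
    rw [connection_congr D h1 (hZ.mono fun y hy ↦ hD Z y hy (W y)), hD _ _ h1,
      (leviCivita I M).isCovariantDerivativeOnUniv.add hWZ (hA hW hZx)]
    simp
    abel
  rw [covDerivHom_apply hA _ hY hZx, covDerivHom_apply hA _ hX hZx]
  -- Rewriting `[X, Y]` as `∇_X Y - ∇_Y X` supplies the correction terms that turn derivatives of
  -- `A_Y Z` and `A_X Z` into `∇A`.
  simp only [curvature, covDeriv, key X hX hXZ, key Y hY hYZ, hD Z x hZx,
    ← leviCivita_torsion hX hY, map_sub]
  abel

/-- The field `∑ i, A_{e i} (e i)`. -/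
def BilinField.contr (A : BilinField I M) : VField I M :=
  fun x ↦ ∑ i, A x (onb I x i) (onb I x i)

omit [IsManifold I ∞ M] [CompleteSpace E]
  [IsContMDiffRiemannianBundle I ∞ E (fun x : M ↦ TangentSpace I x)] in
lemma contr_eq {n : ℕ} {s : Fin n → VField I M} {U : Set M} (ho : IsOrthonormalOn I s U) {y : M}
    (hy : y ∈ U) : A.contr y = ∑ i, A y (s i y) (s i y) := by
  obtain ⟨b, hb⟩ := ho y hy
  simpa [BilinField.contr, hb] using sum_apply_orthonormalBasis (onb I y) b
    (ContinuousLinearMap.toLinearMap₁₂ (A y))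

lemma inner_leviCivita_frame {n : ℕ} {s : Fin n → VField I M} {U : Set M} {x : M} (hU : U ∈ 𝓝 x)
    (hs : ∀ i, MDiffAt (T% (s i)) x) (ho : IsOrthonormalOn I s U) (v : TangentSpace I x)
    (i j : Fin n) : inner ℝ (s i x) (leviCivita I M (s j) x v) =
      - inner ℝ (s j x) (leviCivita I M (s i) x v) := by
  have h : dotf (s i) (s j) =ᶠ[𝓝 x] fun _ ↦ if i = j then 1 else 0 := by
    filter_upwards [hU] with y hy
    obtain ⟨b, hb⟩ := ho y hy
    simp only [dotf, ← hb, b.inner_eq_ite]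
  have h1 := leviCivita_metric_apply (hs i) (hs j) v
  rw [mvfderiv_congr h, mvfderiv_const, _root_.zero_apply, real_inner_comm] at h1
  linarith

/-- Contraction commutes with `∇` because the metric is parallel. In a frame, the correction terms
pair the skew matrix `g(s_i, ∇_v s_j)` with the symmetrization of `A`, and so vanish. -/
lemma leviCivita_contr (hA : A.IsDiff) {n : ℕ} {s : Fin n → VField I M} {U : Set M} {x : M}
    (hU : U ∈ 𝓝 x) (hs : ∀ i, MDiffAt (T% (s i)) x) (ho : IsOrthonormalOn I s U)
    (v : TangentSpace I x) :
    leviCivita I M A.contr x v = ∑ i, covDerivHom hA x v (onb I x i) (onb I x i) := by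
  have hx := mem_of_mem_nhds hU
  have h1 : ∀ᶠ y in 𝓝 x, A.contr y = ∑ i, A y (s i y) (s i y) := by
    filter_upwards [hU] with y hy using contr_eq ho hy
  rw [connection_congr _ (MDifferentiableAt.sum_section fun i _ ↦ hA (hs i) (hs i)) h1,
    connection_sum _ _ fun i ↦ hA (hs i) (hs i)]
  obtain ⟨b, hb⟩ := ho x hx
  have h2 := sum_apply_orthonormalBasis (onb I x) b
    (ContinuousLinearMap.toLinearMap₁₂ (covDerivHom hA x v))
  simp only [ContinuousLinearMap.toLinearMap₁₂_apply_apply_apply] at h2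
  rw [h2]
  simp only [hb, covDerivHom_apply hA v (hs _) (hs _), covDeriv, _root_.sum_apply,
    Finset.sum_sub_distrib]
  have h3 (j : Fin n) : leviCivita I M (s j) x v =
      ∑ i, inner ℝ (s i x) (leviCivita I M (s j) x v) • s i x := (ho.sum_dotf hx _).symm
  have h4 : ∑ j, A x (s j x) (leviCivita I M (s j) x v) +
      ∑ j, A x (leviCivita I M (s j) x v) (s j x) = 0 := by
    have h5 : ∑ j, A x (leviCivita I M (s j) x v) (s j x) =
        - ∑ j, A x (s j x) (leviCivita I M (s j) x v) := by
      have h6 (j : Fin n) : A x (leviCivita I M (s j) x v) (s j x) =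
          ∑ i, inner ℝ (s i x) (leviCivita I M (s j) x v) • A x (s i x) (s j x) := by
        conv_lhs => rw [h3 j]
        simp only [map_sum, map_smul, _root_.sum_apply, _root_.smul_apply]
      have h7 (j : Fin n) : A x (s j x) (leviCivita I M (s j) x v) =
          ∑ i, inner ℝ (s i x) (leviCivita I M (s j) x v) • A x (s j x) (s i x) := by
        conv_lhs => rw [h3 j]
        simp only [map_sum, map_smul]
      simp only [h6, h7, ← Finset.sum_neg_distrib]
      rw [Finset.sum_comm]
      refine Finset.sum_congr rfl fun i _ ↦ Finset.sum_congr rfl fun j _ ↦ ?_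
      rw [inner_leviCivita_frame hU hs ho, neg_smul]
    rw [h5, add_neg_cancel]
  rw [sub_sub, h4, sub_zero]

lemma two_mul_divergence_contr (hA : A.IsDiff) (hskew : A.IsSkew) {D : AffineConnection I M}
    (hD : ∀ (Z : VField I M) (y : M), MDiffAt (T% Z) y →
      ∀ v, D Z y v = leviCivita I M Z y v + A y (Z y) v)
    {n : ℕ} {s : Fin n → VField I M} {U : Set M} {x : M} (hU : U ∈ 𝓝 x)
    (hs : ∀ y ∈ U, ∀ i, CMDiffAt ∞ (T% (s i)) y) (ho : IsOrthonormalOn I s U) :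
    2 * divergence A.contr x = scalarCurvature D x - scalarCurvature (leviCivita I M) x +
      ‖A.contr x‖ ^ 2 +
      tensorNormSq (fun v w ↦ (1 / 2 : ℝ) • (A x w v - A x v w)) -
      tensorNormSq (fun v w ↦ (1 / 2 : ℝ) • (A x w v + A x v w)) := by
  have hx := mem_of_mem_nhds hU
  set e := onb I x
  set T := covDerivHom hA x
  have hdiv : divergence A.contr x = ∑ i, ∑ j, inner ℝ (T (e i) (e j) (e j)) (e i) := by
    rw [divergence, LinearMap.trace_eq_sum_inner _ e]
    refine Finset.sum_congr rfl fun i _ ↦ ?_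
    rw [ContinuousLinearMap.coe_coe, leviCivita_contr hA hU
      (fun i ↦ (hs x hx i).mdifferentiableAt (by simp)) ho, inner_sum]
    simp only [real_inner_comm, e, T]
  have hcurv : scalarCurvature D x - scalarCurvature (leviCivita I M) x =
      ∑ i, ∑ j, inner ℝ (T (e i) (e j) (e j) - T (e j) (e i) (e j) +
        A x (A x (e j) (e j)) (e i) - A x (A x (e j) (e i)) (e j)) (e i) := by
    simp only [scalarCurvature, ← Finset.sum_sub_distrib, ← inner_sub_left]
    refine Finset.sum_congr rfl fun i _ ↦ Finset.sum_congr rfl fun j _ ↦ ?_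
    have hc (v : TangentSpace I x) : CMDiffAt ∞ (T% (extendVec v)) x :=
      FiberBundle.contMDiffAt_extend ..
    have hm (v : TangentSpace I x) : MDiffAt (T% (extendVec v)) x :=
      FiberBundle.mdifferentiableAt_extend ..
    have hev (v : TangentSpace I x) : ∀ᶠ y in 𝓝 x, MDiffAt (T% (extendVec v)) y := by
      filter_upwards [contMDiffAt_iff_contMDiffAt_nhds (by simp) |>.1
        ((hc v).of_le (m := 1) (by simp))] with y hy using hy.mdifferentiableAt (by simp)
    rw [curvature_sub hA hD (hm _) (hm _) (hev _)
      ((contMDiffAt_leviCivita hU hs ho (hc _) (hc _)).mdifferentiableAt (by simp))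
      ((contMDiffAt_leviCivita hU hs ho (hc _) (hc _)).mdifferentiableAt (by simp))]
    simp only [FiberBundle.extend_apply_self, e, T]
  -- Skewness moves `T (e j) (e i)` to the other factor, which again gives the divergence after
  -- exchanging `i` and `j`.
  have h2 : ∑ i, ∑ j, inner ℝ (T (e j) (e i) (e j)) (e i) = - divergence A.contr x := by
    rw [hdiv, Finset.sum_comm, ← Finset.sum_neg_distrib]
    refine Finset.sum_congr rfl fun i _ ↦ ?_
    rw [← Finset.sum_neg_distrib]
    refine Finset.sum_congr rfl fun j _ ↦ ?_
    rw [covDerivHom_skew hA hskew, real_inner_comm]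
  have h3 : ∑ i, ∑ j, inner ℝ (A x (A x (e j) (e j)) (e i)) (e i) = - ‖A.contr x‖ ^ 2 := by
    rw [← real_inner_self_eq_norm_sq]
    conv_rhs => rw [BilinField.contr, inner_sum, ← Finset.sum_neg_distrib]
    refine Finset.sum_congr rfl fun i _ ↦ ?_
    rw [sum_inner, ← Finset.sum_neg_distrib]
    exact Finset.sum_congr rfl fun j _ ↦ hskew ..
  have h4 : ∑ i, ∑ j, inner ℝ (A x (A x (e j) (e i)) (e j)) (e i) =
      - ∑ i, ∑ j, inner ℝ (A x (e j) (e i)) (A x (e i) (e j)) := by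
    simp only [← Finset.sum_neg_distrib]
    exact Finset.sum_congr rfl fun i _ ↦ Finset.sum_congr rfl fun j _ ↦ hskew ..
  -- Polarization: `|(a - b)/2|² - |(a + b)/2|² = -⟨a, b⟩`.
  have h5 : tensorNormSq (fun v w ↦ (1 / 2 : ℝ) • (A x w v - A x v w)) -
      tensorNormSq (fun v w ↦ (1 / 2 : ℝ) • (A x w v + A x v w)) =
      - ∑ i, ∑ j, inner ℝ (A x (e j) (e i)) (A x (e i) (e j)) := by
    simp only [tensorNormSq, ← Finset.sum_sub_distrib, ← Finset.sum_neg_distrib]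
    refine Finset.sum_congr rfl fun i _ ↦ Finset.sum_congr rfl fun j _ ↦ ?_
    rw [norm_smul, norm_smul, mul_pow, mul_pow, norm_add_sq_real, norm_sub_sq_real]
    norm_num
    ring
  simp only [inner_add_left, inner_sub_left, Finset.sum_add_distrib, Finset.sum_sub_distrib, h2, h3,
    h4, ← hdiv] at hcurv
  linarith

end Curvature

/-! ### The intrinsic torsion in a section of a `G`-structure -/

section Curves

variable {E : Type*} [NormedAddCommGroup E] [NormedSpace ℝ E]
  {H : Type*} [TopologicalSpace H] {I : ModelWithCorners ℝ E H} [I.Boundaryless]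
  {M : Type*} [TopologicalSpace M] [ChartedSpace H M]

/-- The curve is a straight line in the chart at `x`. Without boundary `range I` is everything, so
the derivative within it is an ordinary one. -/
lemma exists_curve_of_model (x : M) (v : E) : ∃ c : ℝ → M, c 0 = x ∧ ContinuousAt c 0 ∧
    ∀ (f : M → ℝ) (f' : E →L[ℝ] ℝ), HasFDerivWithinAt (f ∘ (extChartAt I x).symm) f' (Set.range I)
      (extChartAt I x x) → HasDerivAt (fun t ↦ f (c t)) (f' v) 0 := by
  have hl : HasDerivAt (fun t : ℝ ↦ extChartAt I x x + t • v) v 0 := by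
    simpa using ((hasDerivAt_id (0 : ℝ)).smul_const v).const_add (extChartAt I x x)
  have h0 : extChartAt I x x + (0 : ℝ) • v = extChartAt I x x := by simp
  refine ⟨fun t ↦ (extChartAt I x).symm (extChartAt I x x + t • v), ?_, ?_, fun f f' hf ↦ ?_⟩
  · simp only [h0, extChartAt_to_inv]
  · exact ContinuousAt.comp_of_eq (continuousAt_extChartAt_symm (I := I) x) hl.continuousAt h0
  · rw [I.range_eq_univ, hasFDerivWithinAt_univ] at hf
    exact hf.comp_hasDerivAt_of_eq (0 : ℝ) hl h0.symm

/-- Every tangent vector is the velocity of a curve. -/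
lemma exists_curve (x : M) (v : TangentSpace I x) : ∃ c : ℝ → M, c 0 = x ∧ ContinuousAt c 0 ∧
    ∀ f : M → ℝ, MDiffAt f x → HasDerivAt (fun t ↦ f (c t)) (d% f x v) 0 := by
  obtain ⟨c, h0, hc, h⟩ := exists_curve_of_model (I := I) x v
  exact ⟨c, h0, hc, fun f hf ↦ h f (d% f x) hf.hasMFDerivAt.2⟩

end Curves

/-- Constant coefficients for a fixed linear map: applying `projLie` to a matrix with smooth entries
keeps the entries smooth. -/
lemma linearMap_matrix_apply {n : ℕ} (N : Matrix (Fin n) (Fin n) ℝ →ₗ[ℝ] Matrix (Fin n) (Fin n) ℝ)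
    (B : Matrix (Fin n) (Fin n) ℝ) (i j : Fin n) :
    N B i j = ∑ p, ∑ q, B p q * N (Matrix.single p q 1) i j := by
  conv_lhs => rw [Matrix.matrix_eq_sum_single B]
  have h (p q : Fin n) : Matrix.single p q (B p q) = B p q • Matrix.single p q (1 : ℝ) := by simp
  simp only [h, map_sum, map_smul, Matrix.sum_apply, Matrix.smul_apply, smul_eq_mul]

/-! ### The intrinsic torsion as a differentiable skew tensor field -/

section Torsion

variable {E : Type*} [NormedAddCommGroup E] [NormedSpace ℝ E]
  {H : Type*} [TopologicalSpace H] {I : ModelWithCorners ℝ E H}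
  {M : Type*} [TopologicalSpace M] [ChartedSpace H M] [IsManifold I ∞ M]
  [RiemannianBundle (fun x : M ↦ TangentSpace I x)]
  {n : ℕ} {o : MOrientation n I M} {G : Subgroup (Matrix.specialOrthogonalGroup (Fin n) ℝ)}
  (P : GStructure o G)

namespace GStructure

lemma isOrthonormalOn {s : Fin n → VField I M} {U : Set M}
    (hs : ∀ y ∈ U, (fun i ↦ s i y) ∈ P.frames y) : IsOrthonormalOn I s U := fun y hy ↦ by
  obtain ⟨b, hb, -⟩ := P.isOriented y _ (hs y hy)
  exact ⟨b, fun i ↦ congrFun hb i⟩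

lemma sec_mem_nhds (x : M) : ∃ U ∈ 𝓝 x, (∀ y ∈ U, ∀ i, CMDiffAt ∞ (T% (P.sec x i)) y) ∧
    ∀ y ∈ U, (fun i ↦ P.sec x i y) ∈ P.frames y := by
  obtain ⟨hU, hx, hs, h⟩ := (P.local_section x).choose_spec.choose_spec
  exact ⟨_, hU.mem_nhds hx, fun y hy i ↦ (hs i).contMDiffAt (hU.mem_nhds hy), h⟩

end GStructure

open GStructure

variable [FiniteDimensional ℝ E] [CompleteSpace E]
  [IsContMDiffRiemannianBundle I ∞ E (fun x : M ↦ TangentSpace I x)]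

/-- The matrix of the `𝔤^⊥`-component of the connection form, with the opposite sign. -/
def torsionForm (G : Subgroup (Matrix.specialOrthogonalGroup (Fin n) ℝ)) (s : Fin n → VField I M)
    (x : M) : TangentSpace I x →ₗ[ℝ] Matrix (Fin n) (Fin n) ℝ :=
  (projLie G - LinearMap.id) ∘ₗ connectionForm s x

lemma torsionForm_transpose {s : Fin n → VField I M} {U : Set M} {x : M} (hU : U ∈ 𝓝 x)
    (hs : ∀ i, MDiffAt (T% (s i)) x) (ho : IsOrthonormalOn I s U) (v : TangentSpace I x) :
    (torsionForm G s x v)ᵀ = - torsionForm G s x v := by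
  have h1 := transpose_eq_neg_of_mem_lieAlg (projLie_mem (G := G) (connectionForm s x v))
  have h2 : (connectionForm s x v)ᵀ = - connectionForm s x v := by
    ext i j
    exact inner_leviCivita_frame hU hs ho v j i
  simp only [torsionForm, LinearMap.comp_apply, LinearMap.sub_apply, LinearMap.id_apply,
    Matrix.transpose_sub, h1, h2]
  abel

/-- The intrinsic torsion computed in the frame `s`. -/
def frameTorsion (G : Subgroup (Matrix.specialOrthogonalGroup (Fin n) ℝ)) (s : Fin n → VField I M)
    (x : M) (v w : TangentSpace I x) : TangentSpace I x :=
  ∑ i, (torsionForm G s x v *ᵥ fun j ↦ inner ℝ (s j x) w) i • s i x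

namespace GStructure

lemma minimalConnection_apply {Y : VField I M} {x : M} (hY : MDiffAt (T% Y) x)
    (v : TangentSpace I x) : P.minimalConnection Y x v =
      leviCivita I M Y x v + P.torsion x v (Y x) := by
  rw [torsion, CovariantDerivative.difference, IsCovariantDerivativeOn.difference_apply _ _ (hσ := hY)]
  simp

/-- By metricity, `d g(s_i, Y)` is the `i`-th coefficient of `∇Y` minus `∑ j, ω_{ij} Y_j`. So
passing from `∇` to `∇^G` adds exactly the matrix `ω_𝔤 - ω`. -/
lemma torsion_eq_frameTorsion_sec (x : M) (v w : TangentSpace I x) :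
    P.torsion x v w = frameTorsion G (P.sec x) x v w := by
  obtain ⟨U, hU, hs, hP⟩ := P.sec_mem_nhds x
  have hx := mem_of_mem_nhds hU
  have ho := P.isOrthonormalOn hP
  have hw : MDiffAt (T% (extendVec w)) x := FiberBundle.mdifferentiableAt_extend ..
  have hwx : extendVec w x = w := FiberBundle.extend_apply_self ..
  have h1 := P.minimalConnection_apply hw v
  rw [hwx] at h1
  rw [← sub_eq_iff_eq_add'.2 h1, ← ho.sum_dotf hx (leviCivita I M (extendVec w) x v)]
  simp only [minimalConnection, _root_.sum_apply, ContinuousLinearMap.smulRight_apply,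
    ← Finset.sum_sub_distrib, ← sub_smul, frameTorsion]
  refine Finset.sum_congr rfl fun i _ ↦ ?_
  congr 1
  rw [_root_.add_apply, leviCivita_metric_apply (P.sec_mdiff x i) hw v, hwx]
  have h2 : inner ℝ (leviCivita I M (P.sec x i) x v) w =
      - ∑ j, connectionForm (P.sec x) x v i j * inner ℝ (P.sec x j x) w := by
    conv_lhs => rw [← ho.sum_dotf hx (leviCivita I M (P.sec x i) x v)]
    rw [sum_inner, ← Finset.sum_neg_distrib]
    refine Finset.sum_congr rfl fun j _ ↦ ?_
    rw [inner_smul_left, inner_leviCivita_frame hU (P.sec_mdiff x) ho]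
    simp [connectionForm]
  rw [h2]
  simp [Matrix.mulVec, dotProduct, dotf, torsionForm, mul_sub, mul_comm]
  ring

variable [I.Boundaryless]

/-- The `𝔤^⊥`-component of the connection form transforms by conjugation. -/
lemma torsionForm_change {s t : Fin n → VField I M} {U : Set M} {x : M} (hU : U ∈ 𝓝 x)
    (hs : ∀ i, MDiffAt (T% (s i)) x) (ht : ∀ i, MDiffAt (T% (t i)) x)
    (hsP : ∀ y ∈ U, (fun i ↦ s i y) ∈ P.frames y) (htP : ∀ y ∈ U, (fun i ↦ t i y) ∈ P.frames y)
    {A : Matrix.specialOrthogonalGroup (Fin n) ℝ} (hA : A ∈ G)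
    (htA : (fun i ↦ t i x) = frameAct (fun i ↦ s i x) A.1) (v : TangentSpace I x) :
    torsionForm G t x v = A.1ᵀ * torsionForm G s x v * A.1 := by
  have hx := mem_of_mem_nhds hU
  have hso := P.isOrthonormalOn hsP
  -- The transition matrix is determined by the two frames, so its entries are the differentiable
  -- functions `g(s_i, t_j)`.
  have hcoef {y : M} (hy : y ∈ U) {B : Matrix.specialOrthogonalGroup (Fin n) ℝ}
      (h : (fun i ↦ t i y) = frameAct (fun i ↦ s i y) B.1) (i j : Fin n) :
      dotf (s i) (t j) y = B.1 i j := by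
    obtain ⟨b, hb⟩ := hso y hy
    have h' : t j y = ∑ k, B.1 k j • s k y := congrFun h j
    simp [dotf, h', ← hb, inner_sum, inner_smul_right, b.inner_eq_ite]
  set L : Matrix (Fin n) (Fin n) ℝ := Matrix.of fun i j ↦ d% (dotf (s i) (t j)) x v with hL
  -- This is `A⁻¹ dA(v) ∈ 𝔤`: along a curve with velocity `v`, the transition matrices form a curve
  -- in `G`.
  have hmem : A.1ᵀ * L ∈ lieAlg G := by
    classical
    obtain ⟨c, hc0, hc, hcd⟩ := exists_curve x v
    choose! B hBG hB using fun y (hy : y ∈ U) ↦ P.transitive y _ (hsP y hy) _ (htP y hy)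
    have hBx : B x = A := by
      ext i j
      rw [← hcoef hx (hB x hx), ← hcoef hx htA]
    -- The factor `A⁻¹` makes the curve start at `1`. Off `U` the transition matrix has no meaning,
    -- and the value `1` keeps the curve in `G`; only times near `0` affect the velocity.
    refine ⟨fun t ↦ if c t ∈ U then A⁻¹ * B (c t) else 1, fun t ↦ ?_, ?_, fun i j ↦ ?_⟩
    · by_cases h : c t ∈ U
      · simpa [h] using G.mul_mem (G.inv_mem hA) (hBG _ h)
      · simp [h, G.one_mem]
    · simp [hc0, hx, hBx]
    · have h1 : HasDerivAt (fun τ ↦ ∑ k, A.1 k i * dotf (s k) (t j) (c τ)) ((A.1ᵀ * L) i j) 0 :=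
        HasDerivAt.fun_sum fun k _ ↦ (hcd _ (mdiff_dotf (hs k) (ht j))).const_mul _
      refine h1.congr_of_eventuallyEq ?_
      have h2 : ∀ᶠ τ in 𝓝 0, c τ ∈ U := hc.eventually (by rwa [hc0])
      filter_upwards [h2] with τ hτ
      simp [hτ, coe_inv_SO, Matrix.mul_apply, hcoef hτ (hB _ hτ)]
  -- The gauge transformation law `ω' = A⁻¹ dA + A⁻¹ ω A`.
  have hform : connectionForm t x v = A.1ᵀ * L + A.1ᵀ * connectionForm s x v * A.1 := by
    rw [Matrix.mul_assoc, ← mul_add]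
    ext i j
    have h1 : t i x = ∑ k, A.1 k i • s k x := congrFun htA i
    change inner ℝ (t i x) (leviCivita I M (t j) x v) = _
    rw [h1, sum_inner, Matrix.mul_apply]
    refine Finset.sum_congr rfl fun k _ ↦ ?_
    rw [inner_smul_left, Matrix.transpose_apply]
    congr 1
    have h2 := leviCivita_metric_apply (hs k) (ht j) v
    have h3 : inner ℝ (leviCivita I M (s k) x v) (t j x) =
        - (connectionForm s x v * A.1) k j := by
      have h4 : t j x = ∑ k, A.1 k j • s k x := congrFun htA j
      rw [h4, inner_sum, Matrix.mul_apply, ← Finset.sum_neg_distrib]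
      refine Finset.sum_congr rfl fun l _ ↦ ?_
      rw [inner_smul_right, real_inner_comm, inner_leviCivita_frame hU hs hso]
      simp [connectionForm, mul_comm]
    rw [h3] at h2
    simp only [hL, Matrix.add_apply, Matrix.of_apply]
    linarith
  -- The term `A⁻¹ dA` is fixed by the projection, so projection minus identity kills it.
  simp only [torsionForm, LinearMap.comp_apply, LinearMap.sub_apply, LinearMap.id_apply, hform,
    map_add, projLie_of_mem hmem, projLie_conj _ hA, mul_sub, sub_mul]
  abel

/-- Conjugation of the form cancels the change of frame vectors and coordinates, so any
differentiable local section of `P` computes `ξ`. -/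
lemma torsion_eq_frameTorsion {s : Fin n → VField I M} {U : Set M} {x : M} (hU : U ∈ 𝓝 x)
    (hs : ∀ i, MDiffAt (T% (s i)) x) (hsP : ∀ y ∈ U, (fun i ↦ s i y) ∈ P.frames y)
    (v w : TangentSpace I x) : P.torsion x v w = frameTorsion G s x v w := by
  obtain ⟨U', hU', ht, htP⟩ := P.sec_mem_nhds x
  obtain ⟨A, hA, htA⟩ := P.transitive x _ (hsP x (mem_of_mem_nhds hU)) _
    (htP x (mem_of_mem_nhds hU'))
  have h := P.torsionForm_change (Filter.inter_mem hU hU') hs (P.sec_mdiff x)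
    (fun y hy ↦ hsP y hy.1) (fun y hy ↦ htP y hy.2) hA htA v
  have ht' (i : Fin n) : P.sec x i x = ∑ k, A.1 k i • s k x := congrFun htA i
  have hW : (fun j ↦ inner ℝ (P.sec x j x) w) = A.1ᵀ *ᵥ fun j ↦ inner ℝ (s j x) w := by
    ext j
    simp [ht', sum_inner, inner_smul_left, Matrix.mulVec, dotProduct]
  have hsum (u : Fin n → ℝ) : ∑ i, u i • P.sec x i x = ∑ i, (A.1 *ᵥ u) i • s i x := by
    simp only [ht', Finset.smul_sum, smul_smul, Matrix.mulVec, dotProduct, Finset.sum_smul]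
    rw [Finset.sum_comm]
    simp only [mul_comm]
  rw [torsion_eq_frameTorsion_sec, frameTorsion, frameTorsion, hsum, hW, h]
  simp only [Matrix.mulVec_mulVec]
  have h2 : A.1 * (A.1ᵀ * torsionForm G s x v * A.1 * A.1ᵀ) = torsionForm G s x v := by
    rw [Matrix.mul_assoc _ A.1, mul_transpose_self_of_mem_SO, mul_one, ← Matrix.mul_assoc,
      mul_transpose_self_of_mem_SO, one_mul]
  rw [h2]

omit [I.Boundaryless] in
lemma contMDiffAt_torsionForm {s : Fin n → VField I M} {U : Set M} {x : M} (hU : U ∈ 𝓝 x)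
    (hs : ∀ y ∈ U, ∀ i, CMDiffAt ∞ (T% (s i)) y) (ho : IsOrthonormalOn I s U) (i j k : Fin n) :
    CMDiffAt ∞ (fun y ↦ torsionForm G s y (s k y) i j) x := by
  have hx := mem_of_mem_nhds hU
  have h1 (p q : Fin n) : CMDiffAt ∞ (fun y ↦ connectionForm s y (s k y) p q) x :=
    contMDiffAt_dotf (hs x hx p) (contMDiffAt_leviCivita hU hs ho (hs x hx k) (hs x hx q))
  refine ContMDiffAt.congr_of_eventuallyEq ?_
    (Filter.Eventually.of_forall fun y ↦ linearMap_matrix_apply (projLie G - LinearMap.id) (connectionForm s y (s k y)) i j)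
  exact ContMDiffAt.sum fun p _ ↦ ContMDiffAt.sum fun q _ ↦ (h1 p q).mul contMDiffAt_const

omit [I.Boundaryless] in
lemma frameTorsion_eq
    {s : Fin n → VField I M} {U : Set M} (ho : IsOrthonormalOn I s U) {x : M} (hx : x ∈ U)
    (v w : TangentSpace I x) : frameTorsion G s x v w = ∑ i, ∑ j, ∑ k,
      (torsionForm G s x (s k x) i j * inner ℝ (s k x) v * inner ℝ (s j x) w) • s i x := by
  have h : torsionForm G s x v = ∑ k, inner ℝ (s k x) v • torsionForm G s x (s k x) := by
    conv_lhs => rw [← ho.sum_dotf hx v]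
    simp only [map_sum, map_smul]
  simp only [frameTorsion, Matrix.mulVec, dotProduct, Finset.sum_smul, h, Matrix.sum_apply,
    Matrix.smul_apply, Finset.sum_mul, smul_eq_mul]
  simp only [mul_comm]

/-- The intrinsic torsion as a tensor field. -/
def torsionField : BilinField I M :=
  CovariantDerivative.difference P.minimalConnection (leviCivita I M)

lemma torsionField_isDiff : P.torsionField.IsDiff := fun Y Z x hY hZ ↦ by
  obtain ⟨U, hU, hs, hP⟩ := P.sec_mem_nhds x
  have hx := mem_of_mem_nhds hU
  have ho := P.isOrthonormalOn hP
  have h : MDiffAt (T% (fun y ↦ ∑ i, ∑ j, ∑ k, (torsionForm G (P.sec x) y (P.sec x k y) i j *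
      dotf (P.sec x k) Y y * dotf (P.sec x j) Z y) • P.sec x i y)) x :=
    MDifferentiableAt.sum_section fun i _ ↦ MDifferentiableAt.sum_section fun j _ ↦
      MDifferentiableAt.sum_section fun k _ ↦ MDifferentiableAt.smul_section
        ((((contMDiffAt_torsionForm hU hs ho i j k).mdifferentiableAt (by simp)).mul
          (mdiff_dotf (P.sec_mdiff x k) hY)).mul (mdiff_dotf (P.sec_mdiff x j) hZ))
        (P.sec_mdiff x i)
  refine h.congr_of_eventuallyEq ?_
  -- At a nearby `y` the torsion is defined by `P.sec y`; comparing it with `P.sec x` requires `U`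
  -- to be a neighbourhood of `y` as well.
  filter_upwards [eventually_mem_nhds_iff.2 hU] with y hy
  congr 1
  have h1 := P.torsion_eq_frameTorsion hy
    (fun i ↦ (hs y (mem_of_mem_nhds hy) i).mdifferentiableAt (by simp)) hP (Y y) (Z y)
  rw [frameTorsion_eq ho (mem_of_mem_nhds hy)] at h1
  exact h1

omit [I.Boundaryless] in
-- In an orthonormal frame `ξ_v` has the matrix `ω_𝔤 - ω`, a difference of two skew matrices.
lemma torsionField_isSkew : P.torsionField.IsSkew := fun x u v w ↦ by
  obtain ⟨U, hU, hs, hP⟩ := P.sec_mem_nhds x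
  have hN := torsionForm_transpose (G := G) hU (P.sec_mdiff x) (P.isOrthonormalOn hP) v
  have h (w u : TangentSpace I x) : inner ℝ (P.torsionField x w v) u =
      (torsionForm G (P.sec x) x v *ᵥ fun j ↦ inner ℝ (P.sec x j x) w) ⬝ᵥ
        fun j ↦ inner ℝ (P.sec x j x) u := by
    change inner ℝ (P.torsion x v w) u = _
    rw [torsion_eq_frameTorsion_sec, frameTorsion, sum_inner]
    simp [inner_smul_left, dotProduct]
  rw [real_inner_comm (P.torsionField x u v) w, h, h, dotProduct_comm, Matrix.dotProduct_mulVec, ← Matrix.mulVec_transpose,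
    hN, Matrix.neg_mulVec, neg_dotProduct]

lemma contMDiff_charField : ContMDiff I I.tangent ∞
    (fun x : M ↦ (⟨x, P.charField x⟩ : TangentBundle I M)) := fun x ↦ by
  obtain ⟨U, hU, hs, hP⟩ := P.sec_mem_nhds x
  have hx := mem_of_mem_nhds hU
  have ho := P.isOrthonormalOn hP
  have h : CMDiffAt ∞ (T% (fun y ↦ ∑ i, ∑ j, torsionForm G (P.sec x) y (P.sec x j y) i j •
      P.sec x i y)) x :=
    ContMDiffAt.sum_section fun i _ ↦ ContMDiffAt.sum_section fun j _ ↦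
      (contMDiffAt_torsionForm hU hs ho i j j).smul_section (hs x hx i)
  refine h.congr_of_eventuallyEq ?_
  filter_upwards [eventually_mem_nhds_iff.2 hU] with y hy
  have hyU := mem_of_mem_nhds hy
  congr 1
  change P.torsionField.contr y = _
  rw [contr_eq ho hyU, Finset.sum_comm]
  refine Finset.sum_congr rfl fun k _ ↦ ?_
  refine (P.torsion_eq_frameTorsion hy
    (fun i ↦ (hs y hyU i).mdifferentiableAt (by simp)) hP (P.sec x k y) (P.sec x k y)).trans ?_
  obtain ⟨b, hb⟩ := ho y hyU
  simp [frameTorsion, Matrix.mulVec, dotProduct, ← hb, b.inner_eq_ite]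

end GStructure

end Torsion

end GStr

end

theorem mainTheorem2 {n : ℕ} {M : Type*} [TopologicalSpace M]
    [ChartedSpace (EuclideanSpace ℝ (Fin n)) M] [IsManifold (𝓡 n) ∞ M]
    [RiemannianBundle (fun x : M ↦ TangentSpace (𝓡 n) x)]
    [IsContMDiffRiemannianBundle (𝓡 n) ∞ (EuclideanSpace ℝ (Fin n))
      (fun x : M ↦ TangentSpace (𝓡 n) x)]
    (o : GStr.MOrientation n (𝓡 n) M)
    (G : Subgroup (Matrix.specialOrthogonalGroup (Fin n) ℝ))
    (hG : IsClosed (G : Set (Matrix.specialOrthogonalGroup (Fin n) ℝ)))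
    (P : GStr.GStructure o G) :
    ContMDiff (𝓡 n) (𝓡 n).tangent ∞
      (fun x : M ↦ (⟨x, P.charField x⟩ : TangentBundle (𝓡 n) M)) ∧
    ∀ x : M, 2 * GStr.divergence P.charField x =
      GStr.scalarCurvature P.minimalConnection x - GStr.scalarCurvature (GStr.leviCivita (𝓡 n) M) x
        + ‖P.charField x‖ ^ 2 + GStr.tensorNormSq (P.torsionAlt x)
        - GStr.tensorNormSq (P.torsionSym x) := by
  refine ⟨P.contMDiff_charField, fun x ↦ ?_⟩
  obtain ⟨U, hU, hs, hP⟩ := P.sec_mem_nhds x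
  -- By definition `charField` is the contraction of `torsionField`, and `torsionAlt`, `torsionSym`
  -- are its two parts; `torsionField` takes the direction of differentiation as its second vector
  -- argument.
  exact GStr.two_mul_divergence_contr P.torsionField_isDiff P.torsionField_isSkew
    (fun Z y hZ v ↦ P.minimalConnection_apply hZ v) hU hs (P.isOrthonormalOn hP)
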